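/- **Model.** Consider a network with a finite node set $\mathcal N$, a finite set of directed links $\mathcal E\subseteq\mathcal N\times\mathcal N$ and a finite set $\mathcal K$ of traffic types, type $k$ being destined for the nodes of a set $\mathcal N_k\subseteq\mathcal N$. For each pair $(i,k)$ with $i\notin\mathcal N_k$ node $i$ keeps a queue $i^k$; let $M$ be the number of queues. Let $\hat P_i$ be the peak power of node $i$, let $\Pi$ be the set of power vectors $P\in\mathbb R_+^{\mathcal E}$ with $\sum_{j:(i,j)\in\mathcal E}P_{ij}\le\hat P_i$ for all $i$, let $\mathcal C(P)\subseteq\mathbb R_+^{\mathcal E}$ be the set of link-rate vectors feasible under $P$, and suppose that $\mathcal C(\Pi)=\mathrm{conv}\bigl(\bigcup_{P\in\Pi}\mathcal C(P)\bigr)$ is compact. Per-type service rates $R=(R_{ij}^k)$ are feasible if $R_{ij}^k\ge0$, $R_{ij}^k=0$ whenever $i\in\mathcal N_k$, and $(\sum_kR_{ij}^k)_{(i,j)\in\mathcal E}\in\mathcal C(\Pi)$. They induce the virtual service rates $\tilde R_i^k=\sum_{j:(i,j)\in\mathcal E}R_{ij}^k-\sum_{m:(m,i)\in\mathcal E}R_{mi}^k$,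 one for each queue $i^k$; the (compact, convex) set of all virtual rate vectors induced by feasible rates is the virtual rate region $\mathcal C\subset\mathbb R^M$. **Arrivals.** The vectors $B[t]\in\mathbb R_+^M$ of the work arriving at the queues during the slots $[t,t+1)$, $t=0,1,2,\dots$, are i.i.d. with finite second moments and mean vector $a$. **Iterative MDB policy with convergence time (one slot).** Let $U[t]\in\mathbb R_+^M$ be the queue state at the start of slot $t$; $U[0]$ and $U[1]$ are arbitrary initial states, and the system is non-anticipating: $B[t]$ is independent of the history up to time $t$ (in particular of $U[0],\dots,U[t]$). From time $\tau=1$ on, the instantaneous rates $R(\tau)$ are feasible and integrable over each slot, and the induced virtual rates $\tilde R(\tau)$ satisfy, almost surely: 1. for every $t\ge0$, $\tilde R(t+1)$ maximizes $U[t]\cdot r$ over $r\in\mathcal C$ (any maximizer is allowed); 2. for every $t\ge1$, $\tau\mapsto U[t]\cdot\tilde R(\tau)$ is nondecreasing on $[t,t+1)$; 3. for every $t\ge1$, $U[t+1]\le\bigl(U[t]-\tilde R[t]+B[t]\bigr)^+$ componentwise, where $\tilde R[t]=\int_t^{t+1}\tilde R(\tau)\,d\tau$. **Theorem 4.** The iterative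 MDB policy with convergence time is throughput optimal: if $a\in\mathrm{int}\,\mathcal C$, then every queue $i^k$ is stable, that is, $$\limsup_{n\to\infty}\frac1n\sum_{t=1}^n\mathbb P\bigl[U_i^k[t]>\xi\bigr]\longrightarrow0\qquad\text{as }\xi\to\infty.$$ -/

import Mathlib

open MeasureTheory ProbabilityTheory Filter Topology

/-- A wireless multi-hop network with nodes `N` and traffic types `K`: directed links, the
destination set of each traffic type, the peak power of each node, and the instantaneous feasible
rate region of each power allocation (a general set of nonnegative link-rate vectors). -/
structure WirelessNetwork (N K : Type*) where
  links : Finset (N × N)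
  dest : K → Finset N
  peakPower : N → ℝ
  instRegion : (links → ℝ) → Set (links → ℝ)
  instRegion_nonneg : ∀ P, ∀ R ∈ instRegion P, ∀ e, 0 ≤ R e

namespace WirelessNetwork

variable {N K : Type*} [Fintype N] [DecidableEq N] [Fintype K]

/-- The directed links `(i, j)` of the network. -/
abbrev Link (net : WirelessNetwork N K) : Type _ := net.links

/-- The queues `i^k`: node `i` keeps a buffer for type `k` exactly when `i` is not a destination
of type `k`. -/
abbrev Queue (net : WirelessNetwork N K) : Type _ := {q : N × K // q.1 ∉ net.dest q.2}

/-- The feasible power allocations: nonnegative, with the power spent on the links out of each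
node at most the peak power of that node. -/
def feasiblePower (net : WirelessNetwork N K) : Set (net.Link → ℝ) :=
  {P | (∀ e, 0 ≤ P e) ∧ ∀ i, ∑ e : net.Link with e.1.1 = i, P e ≤ net.peakPower i}

/-- The long-term feasible service rate region: the convex hull of the union of the instantaneous
regions over all feasible power allocations. -/
def longTermRegion (net : WirelessNetwork N K) : Set (net.Link → ℝ) :=
  convexHull ℝ (⋃ P ∈ net.feasiblePower, net.instRegion P)

/-- Feasible per-type service rates `R e k` (the rate at which link `e = (i, j)` serves queue
`i^k`): nonnegative, zero where there is no queue `i^k` to serve, and with aggregate link rates in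
the long-term feasible region. -/
def serviceRegion (net : WirelessNetwork N K) : Set (net.Link → K → ℝ) :=
  {R | (∀ e k, 0 ≤ R e k) ∧ (∀ e k, e.1.1 ∈ net.dest k → R e k = 0) ∧
    (fun e => ∑ k, R e k) ∈ net.longTermRegion}

/-- The virtual service rate of each queue: outgoing minus (nominal) incoming service rate. -/
def virtualRate (net : WirelessNetwork N K) (R : net.Link → K → ℝ) : net.Queue → ℝ :=
  fun q => ∑ e : net.Link with e.1.1 = q.1.1, R e q.1.2
    - ∑ e : net.Link with e.1.2 = q.1.1, R e q.1.2

/-- The virtual service rate region. -/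
def virtualRegion (net : WirelessNetwork N K) : Set (net.Queue → ℝ) :=
  net.virtualRate '' net.serviceRegion

/-- `r` is an optimal rate allocation for the queue state `u`: it maximizes `u ⬝ᵥ r` over the
virtual service rate region. -/
def IsOptimalRate (net : WirelessNetwork N K) (u r : net.Queue → ℝ) : Prop :=
  r ∈ net.virtualRegion ∧ ∀ r' ∈ net.virtualRegion, u ⬝ᵥ r' ≤ u ⬝ᵥ r

/-- The virtual service rates over the slot `[t, t + 1]`. -/
noncomputable def slotRate (net : WirelessNetwork N K) (R : ℝ → net.Link → K → ℝ) (t : ℕ) :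
    net.Queue → ℝ :=
  fun q => ∫ τ in (t : ℝ)..((t : ℝ) + 1), net.virtualRate (R τ) q

/-- One sample path of the network under the iterative MDB policy with convergence time (one slot,
of length one): `u t` is the backlog at the start of slot `t`, `b t` the arrivals during slot `t`
and `R τ` the per-type service rates at the continuous time `τ`. The policy runs from slot `1`
on; `u 0` and `u 1` are the initial data. -/
structure IterativeMDBPath (net : WirelessNetwork N K) (b u : ℕ → net.Queue → ℝ)
    (R : ℝ → net.Link → K → ℝ) : Prop where
  backlog_nonneg : ∀ t q, 0 ≤ u t q
  feasible : ∀ τ : ℝ, 1 ≤ τ → R τ ∈ net.serviceRegion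
  integrable : ∀ t : ℕ, 1 ≤ t → ∀ e k,
    IntervalIntegrable (fun τ => R τ e k) volume (t : ℝ) ((t : ℝ) + 1)
  /-- At the end of slot `t`, which is the start of slot `t + 1`, the rates are optimal for the
  queue state at the start of slot `t`. -/
  optimal : ∀ t : ℕ, net.IsOptimalRate (u t) (net.virtualRate (R ((t : ℝ) + 1)))
  /-- During slot `t` the objective value for the current queue state does not decrease. -/
  monotone : ∀ t : ℕ, 1 ≤ t →
    MonotoneOn (fun τ : ℝ => u t ⬝ᵥ net.virtualRate (R τ)) (Set.Ico (t : ℝ) ((t : ℝ) + 1))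
  dynamics : ∀ t : ℕ, 1 ≤ t → ∀ q, u (t + 1) q ≤ max (u t q - net.slotRate R t q + b t q) 0

/-- The network with random arrivals `B`, operated by the iterative MDB policy with convergence
time: almost every sample path is a path of the policy, and the system is non-anticipating, that
is, the arrivals during slot `t` are independent of the history up to the start of slot `t`. -/
structure IsIterativeMDB (net : WirelessNetwork N K) {Ω : Type*} [mΩ : MeasurableSpace Ω]
    (μ : Measure Ω) (B U : ℕ → Ω → net.Queue → ℝ) (R : ℝ → Ω → net.Link → K → ℝ) : Prop where
  path : ∀ᵐ ω ∂μ, net.IterativeMDBPath (fun t => B t ω) (fun t => U t ω) (fun τ => R τ ω)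
  causal : ∃ ℱ : Filtration ℕ mΩ,
    (∀ t, Measurable[ℱ t] (U t)) ∧ (∀ t, Measurable[ℱ (t + 1)] (B t)) ∧
      ∀ t, Indep (MeasurableSpace.comap (B t) inferInstance) (ℱ t) μ

end WirelessNetwork

/-- `B 0, B 1, …` are i.i.d. nonnegative random vectors with finite second moments and mean
vector `a`. -/
structure IsIIDArrival {Ω ι : Type*} [MeasurableSpace Ω] (μ : Measure Ω)
    (B : ℕ → Ω → ι → ℝ) (a : ι → ℝ) : Prop where
  measurable : ∀ t, Measurable (B t)
  indep : iIndepFun B μ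
  identDistrib : ∀ t, IdentDistrib (B t) (B 0) μ μ
  nonneg : ∀ t, ∀ᵐ ω ∂μ, ∀ q, 0 ≤ B t ω q
  memLp_two : ∀ t q, MemLp (fun ω => B t ω q) 2 μ
  mean : ∀ t q, ∫ ω, B t ω q ∂μ = a q

/-- A queue with backlog process `X` is stable if
`limsup_{n → ∞} (1/n) ∑_{t=1}^n P(X t > ξ) → 0` as `ξ → ∞`. -/
def IsStableQueue {Ω : Type*} [MeasurableSpace Ω] (μ : Measure Ω) (X : ℕ → Ω → ℝ) : Prop :=
  Tendsto (fun ξ : ℝ =>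
    limsup (fun n : ℕ => (1 / (n : ℝ)) * ∑ t ∈ Finset.Icc 1 n, μ.real {ω | ξ < X t ω}) atTop)
    atTop (𝓝 0)

/-! Write `u t` for the backlog at time `t`. The rates used during slot `t` are optimal not for
`u t` but for `u (t - 1)`, and since all virtual rates are bounded by some `D`, this costs at most
`2 * D * ‖u t - u (t - 1)‖₁` in the objective. The loss need not be small, because the backlog may
drop arbitrarily fast; but a drop is paid for by the backlog itself:
`|x - y| + x = max (2 * x - y) y`, where the new backlog `x` of a queue exceeds the old backlog
`y` by at most the work arriving in the slot plus `D`. Hence the usual quadratic Lyapunov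
function, augmented by `4 * D * (‖u t - u (t - 1)‖₁ + ‖u t‖₁)`, has a drift of at most
`2 * u t ⬝ᵥ (b t - r)` plus a quadratic expression in the arrivals `b t`, for every feasible `r`.
Choosing `r` strictly above the mean arrivals gives negative drift in expectation, and Markov's
inequality gives stability. The initial states need not be integrable, so expectations are taken
on events, determined by the initial states, where the initial value of the Lyapunov function is
bounded. -/

section Stability

variable {Ω : Type*} [MeasurableSpace Ω] {μ : Measure Ω} {X : ℕ → Ω → ℝ}

lemma IsStableQueue.of_forall_eventually_le
    (h : ∀ c > 0, ∀ᶠ ξ : ℝ in atTop, ∀ᶠ n : ℕ in atTop,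
      (1 / (n : ℝ)) * ∑ t ∈ Finset.Icc 1 n, μ.real {ω | ξ < X t ω} ≤ c) :
    IsStableQueue μ X := by
  have hnonneg : ∀ (ξ : ℝ) (n : ℕ),
      0 ≤ (1 / (n : ℝ)) * ∑ t ∈ Finset.Icc 1 n, μ.real {ω | ξ < X t ω} :=
    fun ξ n => by positivity
  refine tendsto_order.2 ⟨fun c hc => ?_, fun c hc => ?_⟩
  · filter_upwards [h 1 one_pos] with ξ hξ
    exact hc.trans_le
      (le_limsup_of_frequently_le (Frequently.of_forall (hnonneg ξ))
        (isBoundedUnder_of_eventually_le hξ))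
  · filter_upwards [h (c / 2) (half_pos hc)] with ξ hξ
    exact (limsup_le_of_le (isCoboundedUnder_le_of_le atTop (hnonneg ξ)) hξ).trans_lt
      (half_lt_self hc)

lemma measureReal_lt_le_compl_add_setIntegral_div [IsFiniteMeasure μ] {Y : Ω → ℝ} {A : Set Ω}
    (hA : MeasurableSet A) (hY0 : 0 ≤ᵐ[μ.restrict A] Y) (hY : IntegrableOn Y A μ) {ξ : ℝ}
    (hξ : 0 < ξ) :
    μ.real {ω | ξ < Y ω} ≤ μ.real Aᶜ + (∫ ω in A, Y ω ∂μ) / ξ := by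
  have hsub : {ω | ξ < Y ω} ⊆ Aᶜ ∪ {ω | ξ ≤ Y ω} ∩ A := fun ω hω =>
    (em (ω ∈ A)).elim (fun hωA => .inr ⟨le_of_lt (α := ℝ) hω, hωA⟩) .inl
  have hmarkov := mul_meas_ge_le_integral_of_nonneg hY0 hY ξ
  rw [measureReal_restrict_apply' hA, ← le_div_iff₀' hξ] at hmarkov
  calc μ.real {ω | ξ < Y ω} ≤ μ.real Aᶜ + μ.real ({ω | ξ ≤ Y ω} ∩ A) :=
        (measureReal_mono hsub).trans (measureReal_union_le _ _)
    _ ≤ μ.real Aᶜ + (∫ ω in A, Y ω ∂μ) / ξ := by gcongr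

lemma IsStableQueue.of_forall_exists_sum_setIntegral_le [IsFiniteMeasure μ]
    (hX : ∀ t ≥ 1, 0 ≤ᵐ[μ] X t)
    (h : ∀ δ > 0, ∃ A : Set Ω, MeasurableSet A ∧ μ.real Aᶜ ≤ δ ∧
      (∀ t ≥ 1, IntegrableOn (X t) A μ) ∧
      ∃ C : ℝ, ∀ n ≥ 1, ∑ t ∈ Finset.Icc 1 n, ∫ ω in A, X t ω ∂μ ≤ n * C) :
    IsStableQueue μ X := by
  refine .of_forall_eventually_le fun c hc => ?_
  obtain ⟨A, hA, hAc, hint, C, hC⟩ := h (c / 2) (half_pos hc)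
  have hξ : ∀ᶠ ξ : ℝ in atTop, C / ξ < c / 2 :=
    (tendsto_const_nhds.div_atTop tendsto_id).eventually_lt_const (half_pos hc)
  filter_upwards [hξ, eventually_gt_atTop 0] with ξ hξ hξ0
  filter_upwards [eventually_ge_atTop 1] with n hn
  have hn0 : (0 : ℝ) < n := by exact_mod_cast hn
  rw [one_div, inv_mul_le_iff₀ hn0]
  calc ∑ t ∈ Finset.Icc 1 n, μ.real {ω | ξ < X t ω}
      ≤ ∑ t ∈ Finset.Icc 1 n, (c / 2 + (∫ ω in A, X t ω ∂μ) / ξ) := by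
        refine Finset.sum_le_sum fun t ht => ?_
        have ht1 : 1 ≤ t := (Finset.mem_Icc.1 ht).1
        exact (measureReal_lt_le_compl_add_setIntegral_div hA (ae_restrict_of_ae (hX t ht1))
          (hint t ht1) hξ0).trans (by gcongr)
    _ = n * (c / 2) + (∑ t ∈ Finset.Icc 1 n, ∫ ω in A, X t ω ∂μ) / ξ := by
        rw [Finset.sum_add_distrib, Finset.sum_const, ← Finset.sum_div, Nat.card_Icc,
          Nat.add_sub_cancel, nsmul_eq_mul]
    _ ≤ n * (c / 2) + n * C / ξ := by gcongr; exact hC n hn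
    _ = n * (c / 2 + C / ξ) := by ring
    _ ≤ n * (c / 2 + c / 2) := by gcongr
    _ = n * c := by rw [add_halves]

lemma exists_measureReal_compl_sublevel_le [IsProbabilityMeasure μ] {W : Ω → ℝ}
    (hW : Measurable W) {δ : ℝ} (hδ : 0 < δ) :
    ∃ m : ℝ, 0 ≤ m ∧ μ.real {ω | W ω ≤ m}ᶜ ≤ δ := by
  have := Measure.isProbabilityMeasure_map (μ := μ) hW.aemeasurable
  have hcdf : ∀ᶠ m in atTop, 1 - δ < cdf (μ.map W) m :=
    (tendsto_cdf_atTop _).eventually_const_lt (sub_lt_self 1 hδ)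
  obtain ⟨m, hm, hm0⟩ := (hcdf.and (eventually_ge_atTop 0)).exists
  rw [cdf_eq_real, map_measureReal_apply hW measurableSet_Iic] at hm
  refine ⟨m, hm0, ?_⟩
  rw [probReal_compl_eq_one_sub (measurableSet_le hW measurable_const)]
  exact (sub_lt_comm.1 hm).le

lemma le_add_sum_Icc_of_succ_le_add {v z : ℕ → ℝ} (h : ∀ t ≥ 1, v (t + 1) ≤ v t + z t) (n : ℕ) :
    v (n + 1) ≤ v 1 + ∑ t ∈ Finset.Icc 1 n, z t := by
  induction n with
  | zero => simp
  | succ n ih =>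
    rw [Finset.sum_Icc_succ_top (by lia)]
    linarith [h (n + 1) (by lia)]

lemma neg_le_sum_setIntegral_of_drift [IsProbabilityMeasure μ] {V Z : ℕ → Ω → ℝ} {A : Set Ω}
    {m : ℝ} (hm : 0 ≤ m) (hA : MeasurableSet A) (hAV : ∀ ω ∈ A, V 1 ω ≤ m)
    (hV : ∀ t, 0 ≤ᵐ[μ] V t) (hdrift : ∀ t ≥ 1, V (t + 1) ≤ᵐ[μ] V t + Z t)
    (hZ : ∀ t ≥ 1, IntegrableOn (Z t) A μ) (n : ℕ) :
    -m ≤ ∑ t ∈ Finset.Icc 1 n, ∫ ω in A, Z t ω ∂μ := by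
  have hZn : ∀ t ∈ Finset.Icc 1 n, IntegrableOn (Z t) A μ := fun t ht =>
    hZ t (Finset.mem_Icc.1 ht).1
  have hlower : (fun _ => -m) ≤ᵐ[μ.restrict A] fun ω => ∑ t ∈ Finset.Icc 1 n, Z t ω := by
    filter_upwards [ae_restrict_of_ae (hV (n + 1)), ae_restrict_mem hA,
      ae_restrict_of_ae (ae_all_iff.2 fun t => eventually_imp_distrib_left.2 (hdrift t))]
      with ω hVω hωA hω
    have h0 : 0 ≤ V (n + 1) ω := hVω
    linarith [le_add_sum_Icc_of_succ_le_add (v := fun t => V t ω) (z := fun t => Z t ω) hω n,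
      hAV ω hωA]
  have hint := integral_mono_ae (integrable_const _) (integrable_finsetSum _ hZn) hlower
  rw [integral_finsetSum _ hZn, integral_const, measureReal_restrict_apply_univ,
    smul_eq_mul] at hint
  nlinarith [measureReal_le_one (μ := μ) (s := A)]

lemma IsStableQueue.of_lyapunov_drift [IsProbabilityMeasure μ] {V Z : ℕ → Ω → ℝ} {ε : ℝ}
    (hε : 0 < ε) (hX : ∀ t ≥ 1, 0 ≤ᵐ[μ] X t) (hV1 : Measurable (V 1)) (hV : ∀ t, 0 ≤ᵐ[μ] V t)
    (hdrift : ∀ t ≥ 1, V (t + 1) ≤ᵐ[μ] V t + Z t)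
    (hXint : ∀ m, ∀ t ≥ 1, IntegrableOn (X t) {ω | V 1 ω ≤ m} μ)
    (hZint : ∀ m, ∀ t ≥ 1, IntegrableOn (Z t) {ω | V 1 ω ≤ m} μ)
    (hZ : ∀ m, ∃ c, ∀ t ≥ 1,
      ∫ ω in {ω | V 1 ω ≤ m}, Z t ω ∂μ + ε * ∫ ω in {ω | V 1 ω ≤ m}, X t ω ∂μ ≤ c) :
    IsStableQueue μ X := by
  refine .of_forall_exists_sum_setIntegral_le hX fun δ hδ => ?_
  obtain ⟨m, hm0, hm⟩ := exists_measureReal_compl_sublevel_le (μ := μ) hV1 hδ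
  obtain ⟨c, hc⟩ := hZ m
  have hA : MeasurableSet {ω | V 1 ω ≤ m} := measurableSet_le hV1 measurable_const
  refine ⟨_, hA, hm, hXint m, (m + c) / ε, fun n hn => ?_⟩
  have hlower := neg_le_sum_setIntegral_of_drift hm0 hA (fun _ h => h) hV hdrift (hZint m) n
  have hupper := Finset.sum_le_sum fun t ht => hc t (Finset.mem_Icc.1 ht : 1 ≤ t ∧ t ≤ n).1
  rw [Finset.sum_add_distrib, ← Finset.mul_sum] at hupper
  simp only [Finset.sum_const, Nat.card_Icc, Nat.add_sub_cancel, nsmul_eq_mul] at hupper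
  have hn1 : (1 : ℝ) ≤ n := by exact_mod_cast hn
  rw [← mul_div_assoc, le_div_iff₀' hε]
  nlinarith

end Stability

section Integration

variable {Ω ι : Type*} {m mΩ : MeasurableSpace Ω} {μ : Measure Ω} {A : Set Ω}

lemma integrable_of_le_add {X Y : ℕ → Ω → ℝ} {t₀ : ℕ}
    (hX : ∀ t, AEStronglyMeasurable (X t) μ) (hX0 : ∀ t, 0 ≤ᵐ[μ] X t)
    (hY : ∀ t, Integrable (Y t) μ) (hle : ∀ t ≥ t₀, X (t + 1) ≤ᵐ[μ] X t + Y t)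
    (hinit : Integrable (X t₀) μ) {t : ℕ} (ht : t₀ ≤ t) : Integrable (X t) μ := by
  induction t, ht using Nat.le_induction with
  | base => exact hinit
  | succ t ht ih =>
    refine (ih.add (hY t)).mono' (hX (t + 1)) ?_
    filter_upwards [hX0 (t + 1), hle t ht] with ω h0 h
    rwa [Real.norm_of_nonneg h0]

lemma indepFun_indicator_of_indep {β : Type*} [MeasurableSpace β] {f : Ω → β} {Y : Ω → ℝ}
    (hA : MeasurableSet[m] A) (hY : Measurable[m] Y)
    (hind : Indep (MeasurableSpace.comap f inferInstance) m μ) :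
    IndepFun (A.indicator Y) f μ :=
  (IndepFun_iff_Indep _ _ _).2 (indep_of_indep_of_le_left hind.symm (hY.indicator hA).comap_le)

lemma indepFun_indicator_sub_of_indep {U B : Ω → ι → ℝ} (hA : MeasurableSet[m] A)
    (hU : Measurable[m] U) (hind : Indep (MeasurableSpace.comap B inferInstance) m μ)
    (r : ι → ℝ) (q : ι) :
    IndepFun (A.indicator fun ω => U ω q) (fun ω => B ω q - r q) μ := by
  have hsub : Measurable fun b : ι → ℝ => b q - r q := (measurable_pi_apply q).sub_const _
  exact (indepFun_indicator_of_indep hA ((measurable_pi_apply q).comp hU) hind).comp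
    measurable_id hsub

lemma integrableOn_mul_of_indepFun_indicator {Y ξ : Ω → ℝ} (hA : MeasurableSet A)
    (hind : IndepFun (A.indicator Y) ξ μ) (hY : IntegrableOn Y A μ) (hξ : Integrable ξ μ) :
    IntegrableOn (fun ω => Y ω * ξ ω) A μ := by
  rw [← integrable_indicator_iff hA] at hY ⊢
  exact (hind.integrable_mul hY hξ).congr
    (.of_forall fun ω => (Set.indicator_mul_left A Y ξ).symm)

lemma setIntegral_mul_of_indepFun_indicator {Y ξ : Ω → ℝ} (hA : MeasurableSet A)
    (hind : IndepFun (A.indicator Y) ξ μ) (hY : IntegrableOn Y A μ) (hξ : Integrable ξ μ) :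
    ∫ ω in A, Y ω * ξ ω ∂μ = (∫ ω in A, Y ω ∂μ) * ∫ ω, ξ ω ∂μ := by
  rw [← integrable_indicator_iff hA] at hY
  rw [← integral_indicator hA, ← integral_indicator hA]
  simp only [Set.indicator_mul_left]
  exact hind.integral_mul_eq_mul_integral hY.1 hξ.1

lemma integrable_two_mul_sq_add [IsFiniteMeasure μ] {f : Ω → ℝ} (hf : MemLp f 2 μ) (c : ℝ) :
    Integrable (fun ω => 2 * f ω ^ 2 + c) μ :=
  (hf.integrable_sq.const_mul 2).add (integrable_const c)

end Integration

section Vectors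

variable {ι : Type*}

lemma exists_pos_add_mem_of_mem_interior {s : Set (ι → ℝ)} {a : ι → ℝ} (ha : a ∈ interior s) :
    ∃ ε > 0, (fun q => a q + ε) ∈ s := by
  have hcont : Tendsto (fun ε : ℝ => fun q => a q + ε) (𝓝[>] 0) (𝓝 a) := by
    have : Continuous fun ε : ℝ => fun q => a q + ε := by fun_prop
    simpa using (this.tendsto 0).mono_left nhdsWithin_le_nhds
  obtain ⟨ε, hmem, hε⟩ := ((hcont.eventually (mem_interior_iff_mem_nhds.1 ha)).and
    self_mem_nhdsWithin).exists
  exact ⟨ε, hε, hmem⟩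

variable [Fintype ι]

lemma dotProduct_le_add_of_dotProduct_le {D : ℝ} {u w r v : ι → ℝ} (hr : ‖r‖ ≤ D) (hv : ‖v‖ ≤ D)
    (h : w ⬝ᵥ r ≤ w ⬝ᵥ v) : u ⬝ᵥ r ≤ u ⬝ᵥ v + 2 * D * ∑ q, |u q - w q| := by
  have hrv : ‖r - v‖ ≤ 2 * D := by linarith [norm_sub_le r v]
  have hpert : (u - w) ⬝ᵥ (r - v) ≤ 2 * D * ∑ q, |u q - w q| := by
    rw [dotProduct, Finset.mul_sum]
    refine Finset.sum_le_sum fun q _ => ?_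
    calc (u - w) q * (r - v) q ≤ |u q - w q| * ‖(r - v) q‖ := by
          rw [Real.norm_eq_abs, ← Pi.sub_apply, ← abs_mul]
          exact le_abs_self _
      _ ≤ |u q - w q| * (2 * D) := by
          gcongr
          exact (norm_le_pi_norm _ q).trans hrv
      _ = 2 * D * |u q - w q| := mul_comm _ _
  rw [sub_dotProduct, dotProduct_sub, dotProduct_sub] at hpert
  linarith

lemma le_add_abs_add_of_le_max {x y r β D : ℝ} (hy : 0 ≤ y) (hr : |r| ≤ D)
    (hx : x ≤ max (y - r + β) 0) : x ≤ y + (|β| + D) := by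
  refine hx.trans (max_le ?_ ?_) <;>
    linarith [neg_le_abs r, le_abs_self β, abs_nonneg β, abs_nonneg r]

/-- The Lyapunov function of the backlog `x`, given the backlog `y` one slot before: the usual sum
of squares, plus terms that absorb the loss from optimizing the rates for outdated backlogs. -/
def lyapunov (D : ℝ) (x y : ι → ℝ) : ℝ :=
  ∑ q, (x q ^ 2 + 4 * D * (|x q - y q| + x q))

/-- A bound for the one-slot drift of the Lyapunov function when the backlog is `y`, the arrivals
are `β` and `r` is a feasible rate vector. -/
def driftBound (D : ℝ) (r y β : ι → ℝ) : ℝ :=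
  2 * (y ⬝ᵥ (β - r)) + ∑ q, (2 * β q ^ 2 + 34 * D ^ 2)

lemma sq_le_lyapunov {D : ℝ} (hD : 0 ≤ D) {x : ι → ℝ} (hx : ∀ q, 0 ≤ x q) (y : ι → ℝ) (q : ι) :
    x q ^ 2 ≤ lyapunov D x y := by
  have hterm : ∀ q, x q ^ 2 ≤ x q ^ 2 + 4 * D * (|x q - y q| + x q) := fun q => by
    have := hx q
    exact le_add_of_nonneg_right (by positivity)
  exact (hterm q).trans
    (Finset.single_le_sum (fun q _ => (sq_nonneg _).trans (hterm q)) (Finset.mem_univ q))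

lemma measurable_lyapunov (D : ℝ) :
    Measurable fun p : (ι → ℝ) × (ι → ℝ) => lyapunov D p.1 p.2 := by
  unfold lyapunov
  fun_prop

lemma sq_add_abs_sub_add_le_of_le_max {x y r β D : ℝ} (hx : 0 ≤ x) (hy : 0 ≤ y) (hr : |r| ≤ D)
    (hdyn : x ≤ max (y - r + β) 0) :
    x ^ 2 + 4 * D * (|x - y| + x)
      ≤ y ^ 2 + 2 * (y * (β - r)) + 4 * D * y + (2 * β ^ 2 + 34 * D ^ 2) := by
  have hD : 0 ≤ D := (abs_nonneg r).trans hr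
  have hinc : x ≤ y + (|β| + D) := le_add_abs_add_of_le_max hy hr hdyn
  have hsq : x ^ 2 ≤ y ^ 2 + 2 * (y * (β - r)) + (|β| + D) ^ 2 := by
    have hnoise : (β - r) ^ 2 ≤ (|β| + D) ^ 2 :=
      sq_le_sq.2 ((abs_sub β r).trans (by gcongr) |>.trans (le_abs_self _))
    have hx_sq : x ^ 2 ≤ (y - r + β) ^ 2 := by
      rw [← sq_abs (y - r + β)]
      exact pow_le_pow_left₀ hx (hdyn.trans (max_le (le_abs_self _) (abs_nonneg _))) 2
    linarith
  have habs : |x - y| + x ≤ 2 * (|β| + D) + y := by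
    cases abs_cases (x - y) <;> linarith [abs_nonneg β]
  -- `10 * D * |β| ≤ β ^ 2 + 25 * D ^ 2`, and `34 = 9 + 25`.
  have hyoung : (|β| + D) ^ 2 + 4 * D * (2 * (|β| + D)) ≤ 2 * β ^ 2 + 34 * D ^ 2 := by
    rw [← sq_abs β]
    nlinarith [sq_nonneg (|β| - 5 * D)]
  have hD_abs := mul_le_mul_of_nonneg_left habs (by positivity : 0 ≤ 4 * D)
  linarith

lemma lyapunov_le_add_driftBound {D : ℝ} {x y w s r β : ι → ℝ} (hx : ∀ q, 0 ≤ x q)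
    (hy : ∀ q, 0 ≤ y q) (hs : ∀ q, |s q| ≤ D) (hdyn : ∀ q, x q ≤ max (y q - s q + β q) 0)
    (hopt : y ⬝ᵥ r ≤ y ⬝ᵥ s + 2 * D * ∑ q, |y q - w q|) :
    lyapunov D x y ≤ lyapunov D y w + driftBound D r y β := by
  have hsum := Finset.sum_le_sum fun q (_ : q ∈ Finset.univ) =>
    sq_add_abs_sub_add_le_of_le_max (hx q) (hy q) (hs q) (hdyn q)
  simp only [lyapunov, driftBound, dotProduct, Pi.sub_apply, mul_add, mul_sub,
    Finset.sum_add_distrib, Finset.sum_sub_distrib, ← Finset.mul_sum] at hsum hopt ⊢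
  linarith

end Vectors

section DriftBound

variable {Ω ι : Type*} [Fintype ι] {m mΩ : MeasurableSpace Ω} {μ : Measure Ω}
  {A : Set Ω} {U B : Ω → ι → ℝ}

lemma integrableOn_dotProduct_sub [IsFiniteMeasure μ] (hm : m ≤ mΩ) (hA : MeasurableSet[m] A)
    (hU : Measurable[m] U) (hind : Indep (MeasurableSpace.comap B inferInstance) m μ)
    (hUint : ∀ q, IntegrableOn (fun ω => U ω q) A μ) (hB : ∀ q, Integrable (fun ω => B ω q) μ)
    (r : ι → ℝ) : IntegrableOn (fun ω => U ω ⬝ᵥ (B ω - r)) A μ :=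
  integrable_finsetSum _ fun q _ => integrableOn_mul_of_indepFun_indicator (hm _ hA)
    (indepFun_indicator_sub_of_indep hA hU hind r q) (hUint q) ((hB q).sub (integrable_const _))

lemma setIntegral_dotProduct_sub [IsProbabilityMeasure μ] (hm : m ≤ mΩ)
    (hA : MeasurableSet[m] A) (hU : Measurable[m] U)
    (hind : Indep (MeasurableSpace.comap B inferInstance) m μ)
    (hUint : ∀ q, IntegrableOn (fun ω => U ω q) A μ) (hB : ∀ q, Integrable (fun ω => B ω q) μ)
    (r : ι → ℝ) :
    ∫ ω in A, U ω ⬝ᵥ (B ω - r) ∂μ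
      = ∑ q, (∫ ω in A, U ω q ∂μ) * (∫ ω, B ω q ∂μ - r q) := by
  have hξ : ∀ q, Integrable (fun ω => B ω q - r q) μ := fun q => (hB q).sub (integrable_const _)
  have hindep := indepFun_indicator_sub_of_indep hA hU hind r
  simp only [dotProduct, Pi.sub_apply]
  rw [integral_finsetSum _ fun q _ =>
    integrableOn_mul_of_indepFun_indicator (hm _ hA) (hindep q) (hUint q) (hξ q)]
  refine Finset.sum_congr rfl fun q _ => ?_
  rw [setIntegral_mul_of_indepFun_indicator (hm _ hA) (hindep q) (hUint q) (hξ q),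
    integral_sub (hB q) (integrable_const _), integral_const, probReal_univ, one_smul]

lemma setIntegral_dotProduct_sub_le [IsProbabilityMeasure μ] (hm : m ≤ mΩ)
    (hA : MeasurableSet[m] A) (hU : Measurable[m] U)
    (hind : Indep (MeasurableSpace.comap B inferInstance) m μ)
    (hU0 : ∀ᵐ ω ∂μ, ∀ q, 0 ≤ U ω q) (hUint : ∀ q, IntegrableOn (fun ω => U ω q) A μ)
    (hB : ∀ q, Integrable (fun ω => B ω q) μ) {r : ι → ℝ} {ε : ℝ} (hε : 0 ≤ ε)
    (hload : ∀ q, ∫ ω, B ω q ∂μ + ε ≤ r q) (q₀ : ι) :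
    ∫ ω in A, U ω ⬝ᵥ (B ω - r) ∂μ ≤ -(ε * ∫ ω in A, U ω q₀ ∂μ) := by
  have hmean : ∀ q, 0 ≤ ∫ ω in A, U ω q ∂μ := fun q =>
    integral_nonneg_of_ae (ae_restrict_of_ae (hU0.mono fun ω hω => hω q))
  rw [setIntegral_dotProduct_sub hm hA hU hind hUint hB r]
  calc ∑ q, (∫ ω in A, U ω q ∂μ) * (∫ ω, B ω q ∂μ - r q)
      ≤ ∑ q, (∫ ω in A, U ω q ∂μ) * -ε := by
        refine Finset.sum_le_sum fun q _ => ?_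
        exact mul_le_mul_of_nonneg_left (by linarith [hload q]) (hmean q)
    _ = -(ε * ∑ q, ∫ ω in A, U ω q ∂μ) := by rw [← Finset.sum_mul]; ring
    _ ≤ -(ε * ∫ ω in A, U ω q₀ ∂μ) := by
        gcongr
        exact Finset.single_le_sum (fun q _ => hmean q) (Finset.mem_univ q₀)

lemma integrableOn_driftBound [IsFiniteMeasure μ] (hm : m ≤ mΩ) (hA : MeasurableSet[m] A)
    (hU : Measurable[m] U) (hind : Indep (MeasurableSpace.comap B inferInstance) m μ)
    (hUint : ∀ q, IntegrableOn (fun ω => U ω q) A μ) (hB : ∀ q, MemLp (fun ω => B ω q) 2 μ)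
    (D : ℝ) (r : ι → ℝ) : IntegrableOn (fun ω => driftBound D r (U ω) (B ω)) A μ :=
  ((integrableOn_dotProduct_sub hm hA hU hind hUint
    (fun q => (hB q).integrable one_le_two) r).const_mul 2).add
    (integrable_finsetSum _ fun q _ => integrable_two_mul_sq_add (hB q) _).integrableOn

lemma setIntegral_driftBound_add_le [IsProbabilityMeasure μ] (hm : m ≤ mΩ)
    (hA : MeasurableSet[m] A) (hU : Measurable[m] U)
    (hind : Indep (MeasurableSpace.comap B inferInstance) m μ)
    (hU0 : ∀ᵐ ω ∂μ, ∀ q, 0 ≤ U ω q) (hUint : ∀ q, IntegrableOn (fun ω => U ω q) A μ)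
    (hB : ∀ q, MemLp (fun ω => B ω q) 2 μ) {M : ι → ℝ} (hM : ∀ q, ∫ ω, B ω q ^ 2 ∂μ ≤ M q)
    {r : ι → ℝ} {ε : ℝ} (hε : 0 ≤ ε) (hload : ∀ q, ∫ ω, B ω q ∂μ + ε ≤ r q) (D : ℝ) (q₀ : ι) :
    ∫ ω in A, driftBound D r (U ω) (B ω) ∂μ + 2 * ε * ∫ ω in A, U ω q₀ ∂μ
      ≤ ∑ q, (2 * M q + 34 * D ^ 2) := by
  have hBint : ∀ q, Integrable (fun ω => B ω q) μ := fun q => (hB q).integrable one_le_two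
  have hsq : ∀ q, Integrable (fun ω => 2 * B ω q ^ 2 + 34 * D ^ 2) μ := fun q =>
    integrable_two_mul_sq_add (hB q) _
  have hdot := setIntegral_dotProduct_sub_le hm hA hU hind hU0 hUint hBint hε hload q₀
  have hquad : ∫ ω in A, ∑ q, (2 * B ω q ^ 2 + 34 * D ^ 2) ∂μ
      ≤ ∑ q, (2 * M q + 34 * D ^ 2) := by
    calc ∫ ω in A, ∑ q, (2 * B ω q ^ 2 + 34 * D ^ 2) ∂μ
        ≤ ∫ ω, ∑ q, (2 * B ω q ^ 2 + 34 * D ^ 2) ∂μ :=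
          setIntegral_le_integral (integrable_finsetSum _ fun q _ => hsq q)
            (.of_forall fun ω => Finset.sum_nonneg fun q _ => by positivity)
      _ = ∑ q, (2 * ∫ ω, B ω q ^ 2 ∂μ + 34 * D ^ 2) := by
          rw [integral_finsetSum _ fun q _ => hsq q]
          refine Finset.sum_congr rfl fun q _ => ?_
          rw [integral_add ((hB q).integrable_sq.const_mul 2) (integrable_const _),
            integral_const_mul, integral_const, probReal_univ, one_smul]
      _ ≤ ∑ q, (2 * M q + 34 * D ^ 2) := by gcongr with q; exact hM q
  simp only [driftBound]
  rw [integral_add ((integrableOn_dotProduct_sub hm hA hU hind hUint hBint r).const_mul 2)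
    (integrable_finsetSum _ fun q _ => hsq q).integrableOn, integral_const_mul]
  linarith

end DriftBound

lemma IsIIDArrival.integral_sq_eq {Ω ι : Type*} [MeasurableSpace Ω] {μ : Measure Ω}
    {B : ℕ → Ω → ι → ℝ} {a : ι → ℝ} (hB : IsIIDArrival μ B a) (t : ℕ) (q : ι) :
    ∫ ω, B t ω q ^ 2 ∂μ = ∫ ω, B 0 ω q ^ 2 ∂μ :=
  ((hB.identDistrib t).comp ((measurable_pi_apply q).pow_const 2)).integral_eq

namespace WirelessNetwork

section Region

variable {N K : Type*} [DecidableEq N]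

lemma continuous_virtualRate (net : WirelessNetwork N K) : Continuous net.virtualRate := by
  unfold virtualRate
  fun_prop

lemma isBounded_virtualRegion [Fintype K] {net : WirelessNetwork N K}
    (h : Bornology.IsBounded net.longTermRegion) :
    Bornology.IsBounded net.virtualRegion := by
  obtain ⟨C, hC⟩ := h.exists_norm_le
  have hsub : net.serviceRegion ⊆ Set.Icc 0 fun _ _ => C := by
    refine fun R ⟨hR0, _, hR⟩ => ⟨hR0, fun e k => ?_⟩
    calc R e k ≤ ∑ k, R e k := Finset.single_le_sum (fun k _ => hR0 e k) (Finset.mem_univ k)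
      _ ≤ ‖∑ k, R e k‖ := Real.le_norm_self _
      _ ≤ ‖fun e => ∑ k, R e k‖ := norm_le_pi_norm (fun e => ∑ k, R e k) e
      _ ≤ C := hC _ hR
  refine Bornology.forall_isBounded_image_eval_iff.1 fun q => ?_
  have hcont : Continuous fun R => net.virtualRate R q :=
    (continuous_apply q).comp net.continuous_virtualRate
  rw [virtualRegion, Set.image_image]
  exact (isCompact_Icc.image hcont).isBounded.subset (Set.image_mono hsub)

end Region

variable {N K : Type*} [Fintype N] [DecidableEq N] [Fintype K] {net : WirelessNetwork N K}

namespace IterativeMDBPath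

variable {b u : ℕ → net.Queue → ℝ} {R : ℝ → net.Link → K → ℝ} {D : ℝ} {t : ℕ}

lemma intervalIntegrable_virtualRate (h : net.IterativeMDBPath b u R) (ht : 1 ≤ t)
    (q : net.Queue) :
    IntervalIntegrable (fun τ => net.virtualRate (R τ) q) volume (t : ℝ) ((t : ℝ) + 1) := by
  have hsum : ∀ s : Finset net.Link, IntervalIntegrable (fun τ => ∑ e ∈ s, R τ e q.1.2) volume
      (t : ℝ) ((t : ℝ) + 1) := fun s => by
    simpa only [Finset.sum_fn] using
      IntervalIntegrable.sum s fun e _ => h.integrable t ht e q.1.2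
  exact (hsum _).sub (hsum _)

lemma abs_slotRate_le (h : net.IterativeMDBPath b u R) (hD : ∀ r ∈ net.virtualRegion, ‖r‖ ≤ D)
    (ht : 1 ≤ t) (q : net.Queue) : |net.slotRate R t q| ≤ D := by
  have ht' : (1 : ℝ) ≤ t := by exact_mod_cast ht
  have hbound : ∀ τ ∈ Set.uIoc (t : ℝ) (t + 1), ‖net.virtualRate (R τ) q‖ ≤ D := fun τ hτ => by
    rw [Set.uIoc_of_le (by linarith)] at hτ
    exact (norm_le_pi_norm _ q).trans (hD _ ⟨R τ, h.feasible τ (by linarith [hτ.1]), rfl⟩)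
  simpa [slotRate] using intervalIntegral.norm_integral_le_of_norm_le_const hbound

lemma dotProduct_virtualRate_le_slotRate (h : net.IterativeMDBPath b u R) (ht : 1 ≤ t) :
    u t ⬝ᵥ net.virtualRate (R t) ≤ u t ⬝ᵥ net.slotRate R t := by
  have hint : ∀ q ∈ (Finset.univ : Finset net.Queue), IntervalIntegrable
      (fun τ => u t q * net.virtualRate (R τ) q) volume (t : ℝ) ((t : ℝ) + 1) :=
    fun q _ => (h.intervalIntegrable_virtualRate ht q).const_mul _
  have hdot : IntervalIntegrable (fun τ => u t ⬝ᵥ net.virtualRate (R τ)) volume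
      (t : ℝ) ((t : ℝ) + 1) := by
    have hsum := IntervalIntegrable.sum _ hint
    rwa [Finset.sum_fn] at hsum
  calc u t ⬝ᵥ net.virtualRate (R t)
      = ∫ _ in (t : ℝ)..((t : ℝ) + 1), u t ⬝ᵥ net.virtualRate (R t) := by simp
    _ ≤ ∫ τ in (t : ℝ)..((t : ℝ) + 1), u t ⬝ᵥ net.virtualRate (R τ) :=
        intervalIntegral.integral_mono_on_of_le_Ioo (by linarith) intervalIntegrable_const hdot
          fun τ hτ => h.monotone t ht ⟨le_rfl, by linarith⟩ ⟨hτ.1.le, hτ.2⟩ hτ.1.le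
    _ = u t ⬝ᵥ net.slotRate R t := by
        simp only [dotProduct, slotRate]
        rw [intervalIntegral.integral_finsetSum hint]
        simp only [intervalIntegral.integral_const_mul]

lemma dotProduct_le_slotRate_add (h : net.IterativeMDBPath b u R)
    (hD : ∀ r ∈ net.virtualRegion, ‖r‖ ≤ D) {r : net.Queue → ℝ} (hr : r ∈ net.virtualRegion)
    (ht : 1 ≤ t) :
    u t ⬝ᵥ r ≤ u t ⬝ᵥ net.slotRate R t + 2 * D * ∑ q, |u t q - u (t - 1) q| := by
  obtain ⟨hmem, hopt⟩ := h.optimal (t - 1)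
  rw [Nat.cast_pred ht, sub_add_cancel] at hmem hopt
  exact (dotProduct_le_add_of_dotProduct_le (hD r hr) (hD _ hmem) (hopt r hr)).trans
    (by gcongr; exact h.dotProduct_virtualRate_le_slotRate ht)

lemma backlog_succ_le (h : net.IterativeMDBPath b u R) (hD : ∀ r ∈ net.virtualRegion, ‖r‖ ≤ D)
    (ht : 1 ≤ t) (q : net.Queue) : u (t + 1) q ≤ u t q + (|b t q| + D) :=
  le_add_abs_add_of_le_max (h.backlog_nonneg t q) (h.abs_slotRate_le hD ht q) (h.dynamics t ht q)

lemma lyapunov_succ_le (h : net.IterativeMDBPath b u R)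
    (hD : ∀ r ∈ net.virtualRegion, ‖r‖ ≤ D) {r : net.Queue → ℝ} (hr : r ∈ net.virtualRegion)
    (ht : 1 ≤ t) :
    lyapunov D (u (t + 1)) (u t)
      ≤ lyapunov D (u t) (u (t - 1)) + driftBound D r (u t) (b t) :=
  lyapunov_le_add_driftBound (h.backlog_nonneg (t + 1)) (h.backlog_nonneg t)
    (h.abs_slotRate_le hD ht) (h.dynamics t ht) (h.dotProduct_le_slotRate_add hD hr ht)

lemma sq_backlog_le_lyapunov (h : net.IterativeMDBPath b u R)
    (hD : ∀ r ∈ net.virtualRegion, ‖r‖ ≤ D) (y : net.Queue → ℝ) (q : net.Queue) :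
    u t q ^ 2 ≤ lyapunov D (u t) y :=
  sq_le_lyapunov ((norm_nonneg _).trans (hD _ (h.optimal 0).1)) (h.backlog_nonneg t) y q

end IterativeMDBPath

namespace IsIterativeMDB

variable {Ω : Type*} [mΩ : MeasurableSpace Ω] {μ : Measure Ω} {B U : ℕ → Ω → net.Queue → ℝ}
  {R : ℝ → Ω → net.Link → K → ℝ} {D : ℝ}

lemma measurable_backlog (h : net.IsIterativeMDB μ B U R) (t : ℕ) : Measurable (U t) := by
  obtain ⟨ℱ, hU, -⟩ := h.causal
  exact (hU t).mono (ℱ.le t) le_rfl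

lemma integrableOn_backlog [IsFiniteMeasure μ] (h : net.IsIterativeMDB μ B U R)
    (hD : ∀ r ∈ net.virtualRegion, ‖r‖ ≤ D) (hB : ∀ t q, Integrable (fun ω => B t ω q) μ) (m : ℝ)
    {t : ℕ} (ht : 1 ≤ t) (q : net.Queue) :
    IntegrableOn (fun ω => U t ω q) {ω | lyapunov D (U 1 ω) (U 0 ω) ≤ m} μ := by
  have hmeas : ∀ t, Measurable fun ω => U t ω q := fun t =>
    (measurable_pi_apply q).comp (h.measurable_backlog t)
  have hA : MeasurableSet {ω | lyapunov D (U 1 ω) (U 0 ω) ≤ m} :=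
    measurableSet_le ((measurable_lyapunov D).comp
      ((h.measurable_backlog 1).prodMk (h.measurable_backlog 0))) measurable_const
  refine integrable_of_le_add (t₀ := 1) (fun t => (hmeas t).aestronglyMeasurable)
    (fun t => ae_restrict_of_ae (h.path.mono fun ω hω => hω.backlog_nonneg t q))
    (fun t => ((hB t q).abs.add (integrable_const D)).integrableOn)
    (fun t ht => ae_restrict_of_ae (h.path.mono fun ω hω => hω.backlog_succ_le hD ht q)) ?_ ht
  refine .of_bound (hmeas 1).aestronglyMeasurable (m + 1) ?_
  filter_upwards [ae_restrict_of_ae h.path, ae_restrict_mem hA] with ω hω hωA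
  rw [Real.norm_of_nonneg (hω.backlog_nonneg 1 q)]
  have hsq : U 1 ω q ^ 2 ≤ m := (hω.sq_backlog_le_lyapunov hD (U 0 ω) q).trans hωA
  nlinarith [sq_nonneg (U 1 ω q - 1)]

end IsIterativeMDB

end WirelessNetwork

theorem theorem4_general {N K : Type*} [Fintype N] [DecidableEq N] [Fintype K]
    (net : WirelessNetwork N K) (hbounded : Bornology.IsBounded net.virtualRegion)
    {Ω : Type*} [MeasurableSpace Ω] (μ : Measure Ω) [IsProbabilityMeasure μ]
    (B U : ℕ → Ω → net.Queue → ℝ) (R : ℝ → Ω → net.Link → K → ℝ)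
    (hB : ∀ t q, MemLp (fun ω => B t ω q) 2 μ)
    {M : net.Queue → ℝ} (hM : ∀ t q, ∫ ω, B t ω q ^ 2 ∂μ ≤ M q)
    {r : net.Queue → ℝ} (hr : r ∈ net.virtualRegion) {ε : ℝ} (hε : 0 < ε)
    (hload : ∀ t q, ∫ ω, B t ω q ∂μ + ε ≤ r q) (hMDB : net.IsIterativeMDB μ B U R) :
    ∀ q : net.Queue, IsStableQueue μ (fun t ω => U t ω q) := by
  intro q
  obtain ⟨D, hD⟩ := hbounded.exists_norm_le
  obtain ⟨ℱ, hU, -, hind⟩ := hMDB.causal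
  have hU0 : ∀ t, ∀ᵐ ω ∂μ, ∀ q, 0 ≤ U t ω q := fun t =>
    hMDB.path.mono fun ω hω => hω.backlog_nonneg t
  have hUint := fun m {t : ℕ} (ht : 1 ≤ t) q =>
    hMDB.integrableOn_backlog hD (fun t q => (hB t q).integrable one_le_two) m ht q
  have hV1 : Measurable[ℱ 1] fun ω => lyapunov D (U 1 ω) (U 0 ω) :=
    (measurable_lyapunov D).comp ((hU 1).prodMk ((hU 0).mono (ℱ.mono zero_le_one) le_rfl))
  have hA : ∀ m, ∀ t ≥ 1, MeasurableSet[ℱ t] {ω | lyapunov D (U 1 ω) (U 0 ω) ≤ m} :=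
    fun m t ht => ℱ.mono ht _ (hV1 measurableSet_Iic)
  exact IsStableQueue.of_lyapunov_drift (V := fun t ω => lyapunov D (U t ω) (U (t - 1) ω))
    (Z := fun t ω => driftBound D r (U t ω) (B t ω)) (mul_pos two_pos hε)
    (fun t _ => (hU0 t).mono fun ω hω => hω q)
    (hV1.mono (ℱ.le 1) le_rfl)
    (fun t => hMDB.path.mono fun ω hω =>
      (sq_nonneg _).trans (hω.sq_backlog_le_lyapunov hD (U (t - 1) ω) q))
    (fun t ht => hMDB.path.mono fun ω hω => hω.lyapunov_succ_le hD hr ht)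
    (fun m t ht => hUint m ht q)
    (fun m t ht => integrableOn_driftBound (ℱ.le t) (hA m t ht) (hU t) (hind t) (hUint m ht)
      (hB t) D r)
    fun m => ⟨_, fun t ht => setIntegral_driftBound_add_le (ℱ.le t) (hA m t ht) (hU t) (hind t)
      (hU0 t) (hUint m ht) (hB t) (hM t) hε.le (hload t) D q⟩

theorem theorem4 {N K : Type*} [Fintype N] [DecidableEq N] [Fintype K]
    (net : WirelessNetwork N K) (hcompact : IsCompact net.longTermRegion)
    {Ω : Type*} [MeasurableSpace Ω] (μ : Measure Ω) [IsProbabilityMeasure μ]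
    (B U : ℕ → Ω → net.Queue → ℝ) (R : ℝ → Ω → net.Link → K → ℝ) (a : net.Queue → ℝ)
    (hB : IsIIDArrival μ B a) (ha : a ∈ interior net.virtualRegion)
    (hMDB : net.IsIterativeMDB μ B U R) :
    ∀ q : net.Queue, IsStableQueue μ (fun t ω => U t ω q) := by
  obtain ⟨ε, hε, haε⟩ := exists_pos_add_mem_of_mem_interior ha
  exact theorem4_general net (WirelessNetwork.isBounded_virtualRegion hcompact.isBounded) μ B U R
    hB.memLp_two (fun t q => (hB.integral_sq_eq t q).le) haε hε
    (fun t q => by rw [hB.mean t q]) hMDB
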